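/- For a (finite or infinite) set $B$ of nonempty finite words of positive integers let $K(B)=\{[0;\gamma_1,\gamma_2,\dots] : \gamma_i\in B \text{ for all } i\ge 1\}$, where $[0;\gamma_1,\gamma_2,\dots]$ is the infinite continued fraction whose partial quotients are the letters of the concatenation $\gamma_1\gamma_2\cdots$. Let $1^k22$ denote the word of $k$ letters $1$ followed by two letters $2$. Let $W$ be Lambert's function, i.e. the inverse of the increasing function $[-1,\infty)\to[-e^{-1},\infty)$, $x\mapsto xe^x$, and let $c_0=-\log\log\bigl((3+\sqrt5)/2\bigr)$. Let $s:\mathbb N\to\{0,1,2,\dots\}\cup\{\infty\}$, and suppose that there is a constant $C>0$ with $$\frac{s(r)\log s(r)}{r+s(r)+5}\ge C$$ for all large $r$ (the condition counts as satisfied when $s(r)=\infty$). Put $B_r=\{1^r22,1^{r+1}22,\dots,1^{r+s(r)}22\}$ (if $s(r)=\infty$, $B_r=\{1^k22: k\ge r\}$). Then, as $r\to\infty$ through the integers, $$\dim_H K(B_r)=\frac{W(r)}{r e^{-c_0}}+O\left(\frac1r\left(\frac{\log r}{r}\right)^{\min\{1,(1+o(1))s(r)/r\}}\right),$$ that is,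 there are a sequence $\varepsilon_r\to0$ and a constant $M$ such that for all large $r$ $$\left|\dim_H K(B_r)-\frac{W(r)}{r e^{-c_0}}\right|\le \frac Mr\left(\frac{\log r}{r}\right)^{\min\{1,(1+\varepsilon_r)s(r)/r\}},$$ where the minimum is $1$ if $s(r)=\infty$. -/

import Mathlib

open Filter Topology

namespace GaussCantor

/-- The concatenation `γ₀γ₁γ₂⋯` of a sequence of finite words, as a sequence of letters. If no word
is empty, the first `n + 1` words have more than `n` letters in total, so the default value of
`getD` is never used. -/
def concat (γ : ℕ → List ℕ) : ℕ → ℕ :=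
  fun n => ((List.range (n + 1)).flatMap γ).getD n 0

/-- The formal infinite continued fraction `[0; a₀, a₁, a₂, …]`. -/
noncomputable def contFrac (a : ℕ → ℕ) : GenContFract ℝ where
  h := 0
  s := Stream'.Seq.ofStream (fun n => (⟨1, (a n : ℝ)⟩ : GenContFract.Pair ℝ))

/-- `x = [0; a₀, a₁, a₂, …]`: the convergents of the continued fraction tend to `x`. -/
def HasContFrac (x : ℝ) (a : ℕ → ℕ) : Prop :=
  Tendsto (fun n => (contFrac a).convs n) atTop (𝓝 x)

/-- `K(B) = {[0; γ₁, γ₂, …] : γᵢ ∈ B}` for an alphabet `B` of finite words. -/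
def gaussCantor (B : Set (List ℕ)) : Set ℝ :=
  {x | ∃ γ : ℕ → List ℕ, (∀ i, γ i ∈ B) ∧ HasContFrac x (concat γ)}

/-- The word `1ᵏ22`. -/
def word (k : ℕ) : List ℕ := List.replicate k 1 ++ [2, 2]

/-- The alphabet `{1^r 22, 1^(r+1) 22, …, 1^(r+s) 22}`; it is infinite if `s = ∞`. -/
def alphabet (r : ℕ) (s : ℕ∞) : Set (List ℕ) :=
  {w | ∃ j : ℕ, (j : ℕ∞) ≤ s ∧ w = word (r + j)}

/-- Lambert's function (principal branch): for `y ≥ -e⁻¹`, the unique `x ≥ -1` with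
`x * exp x = y`. -/
noncomputable def lambertW (y : ℝ) : ℝ :=
  Function.invFunOn (fun x : ℝ => x * Real.exp x) (Set.Ici (-1)) y

/-- `c₀ = -log log ((3 + √5) / 2)`. -/
noncomputable def c₀ : ℝ := -Real.log (Real.log ((3 + Real.sqrt 5) / 2))

/-- `s log s / (r + s + 5) ≥ C`; the left side is read as `∞` if `s = ∞`. -/
def GrowthBound (C : ℝ) (r : ℕ) (s : ℕ∞) : Prop :=
  s = ⊤ ∨ C ≤ (s.toNat : ℝ) * Real.log (s.toNat : ℝ) / ((r : ℝ) + (s.toNat : ℝ) + 5)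

open Classical in
/-- The exponent `min {1, (1 + ε) s / r}`, which is `1` if `s = ∞`. -/
noncomputable def errorExponent (r : ℕ) (s : ℕ∞) (ε : ℝ) : ℝ :=
  if s = ⊤ then 1 else min 1 ((1 + ε) * (s.toNat : ℝ) / (r : ℝ))

end GaussCantor

namespace GaussCantor

/-! ### Convergents and concatenation of words -/

/-! The set is the limit set of the maps `branch k`, `r ≤ k ≤ r + s`, coded by `codePoint`. On `[0,
1]` each `branch k` contracts distances by a factor between `rho ^ (k + 6)` and `rho ^ k / 2`, where
`rho` is the inverse square of the golden ratio. Hence the dimension is pinned by two Moran-type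
conditions: it is at most `D` if `∑ rho ^ ((r + j) D) ≤ 1` over all `j ≥ 0` (`dimH_gaussCantor_le`,
natural covers), and at least `D` if `∑ rho ^ ((r + k + 6) D) ≥ 1` over `k ≤ s`
(`le_dimH_gaussCantor`, a Bernoulli measure and the mass distribution principle).

Write `D = x / (λ r)` with `λ = goldenRate = -log rho`. Both sums are geometric, and to leading
order the equation "sum = 1" reads `x * exp x = r`, so `x ≈ W(r)`. The exact form of the upper sum
and the shift by 6 move `x` by only `O(W / r) = O(log r / r)`. Cutting the alphabet at `s` costs a
term of order `exp (-x s / r)`, which is about `(log r / r) ^ (s / r)` because `exp (-W) = W / r`.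
The explicit forms are `dimH_le_lambertW` and `lambertW_le_dimH`. The growth condition enters only
through `lambertW_mul_div_ge`: it keeps `W s / r` away from 0, so the truncation factor stays
bounded below. -/

theorem contFrac_convs_zero (a : ℕ → ℕ) : (contFrac a).convs 0 = 0 := by
  simp [contFrac]

theorem contFrac_convs'_succ (a : ℕ → ℕ) (n : ℕ) :
    (contFrac a).convs' (n + 1) = 1 / ((a 0 : ℝ) + (contFrac fun i => a (i + 1)).convs' n) := by
  have h : (contFrac a).s.head = some ⟨1, (a 0 : ℝ)⟩ := rfl
  have ht : (contFrac a).s.tail = (contFrac fun i => a (i + 1)).s := by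
    apply Stream'.Seq.ext
    intro n
    rw [Stream'.Seq.get?_tail]
    rfl
  rw [GenContFract.convs', GenContFract.convs', GenContFract.convs'Aux_succ_some h, ht]
  simp [contFrac]

theorem contFrac_convs_eq {a : ℕ → ℕ} (ha : ∀ n, 0 < a n) (n : ℕ) :
    (contFrac a).convs n = (contFrac a).convs' n := by
  apply GenContFract.convs_eq_convs'
  intro gp m _ h
  have h' : some (⟨1, (a m : ℝ)⟩ : GenContFract.Pair ℝ) = some gp := h
  cases h'
  exact ⟨one_pos, Nat.cast_pos.2 (ha m)⟩

theorem contFrac_convs_succ {a : ℕ → ℕ} (ha : ∀ n, 0 < a n) (n : ℕ) :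
    (contFrac a).convs (n + 1) = 1 / ((a 0 : ℝ) + (contFrac fun i => a (i + 1)).convs n) := by
  rw [contFrac_convs_eq ha, contFrac_convs_eq (fun n => ha (n + 1)), contFrac_convs'_succ]

theorem contFrac_convs_mem_Icc {a : ℕ → ℕ} (ha : ∀ n, 0 < a n) (n : ℕ) :
    (contFrac a).convs n ∈ Set.Icc (0 : ℝ) 1 := by
  induction n generalizing a with
  | zero => rw [contFrac_convs_zero]; simp
  | succ n ih =>
    obtain ⟨h0, -⟩ := ih (fun n => ha (n + 1))
    have h1 : (1 : ℝ) ≤ a 0 := by exact_mod_cast ha 0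
    rw [contFrac_convs_succ ha]
    refine ⟨by positivity, ?_⟩
    rw [div_le_one (by positivity)]
    linarith

theorem le_length_flatMap_range {γ : ℕ → List ℕ} (hγ : ∀ i, γ i ≠ []) (m : ℕ) :
    m ≤ ((List.range m).flatMap γ).length := by
  induction m with
  | zero => simp
  | succ m ih =>
    rw [List.range_succ, List.flatMap_append, List.length_append]
    have := List.length_pos_iff.2 (hγ m)
    simp only [List.flatMap_singleton]
    omega

theorem concat_eq_getD {γ : ℕ → List ℕ} (hγ : ∀ i, γ i ≠ []) {n m : ℕ} (h : n < m) :
    concat γ n = ((List.range m).flatMap γ).getD n 0 := by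
  induction m, h using Nat.le_induction with
  | base => rfl
  | succ m hm ih =>
    rw [ih, List.range_succ, List.flatMap_append, List.getD_append]
    exact lt_of_lt_of_le hm (le_length_flatMap_range hγ m)

theorem concat_of_lt {γ : ℕ → List ℕ} {n : ℕ} (h : n < (γ 0).length) :
    concat γ n = (γ 0).getD n 0 := by
  rw [concat, List.range_succ_eq_map, List.flatMap_cons, List.getD_append _ _ _ _ h]

theorem concat_length_add {γ : ℕ → List ℕ} (hγ : ∀ i, γ i ≠ []) (n : ℕ) :
    concat γ ((γ 0).length + n) = concat (fun i => γ (i + 1)) n := by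
  have hpos := List.length_pos_iff.2 (hγ 0)
  rw [concat_eq_getD (fun i => hγ (i + 1)) (show n < (γ 0).length + n by omega), concat,
    List.range_succ_eq_map, List.flatMap_cons, List.getD_append_right _ _ _ _ (by omega),
    Nat.add_sub_cancel_left, List.flatMap_map]

/-! ### The inverse branches -/

/-- The map `y ↦ [0; 1, …, 1, 2, 2 + y]` with `k` letters `1`. -/
noncomputable def branch (k : ℕ) (y : ℝ) : ℝ :=
  (fun z : ℝ => 1 / (1 + z))^[k] (1 / (2 + 1 / (2 + y)))

theorem branch_succ (k : ℕ) (y : ℝ) : branch (k + 1) y = 1 / (1 + branch k y) :=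
  Function.iterate_succ_apply' _ _ _

theorem word_ne_nil (k : ℕ) : word k ≠ [] := by simp [word]

theorem length_word (k : ℕ) : (word k).length = k + 2 := by simp [word]

theorem word_succ (k : ℕ) : word (k + 1) = 1 :: word k := by
  simp [word, List.replicate_succ]

theorem mem_word_pos {k x : ℕ} (h : x ∈ word k) : 0 < x := by
  simp only [word, List.mem_append, List.mem_replicate, List.mem_cons] at h
  rcases h with h | h | h | h <;> simp_all

/-- This translates continued fractions into dynamics: prefixing a word acts on convergents as the
corresponding inverse branch. -/
theorem convs_of_word_prefix {k : ℕ} {a : ℕ → ℕ} (ha : ∀ n, 0 < a n)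
    (h : ∀ n < k + 2, a n = (word k).getD n 0) (n : ℕ) :
    (contFrac a).convs (k + 2 + n) = branch k ((contFrac fun i => a (k + 2 + i)).convs n) := by
  induction k generalizing a with
  | zero =>
    have h0 : a 0 = 2 := h 0 (by omega)
    have h1 : a 1 = 2 := h 1 (by omega)
    rw [show 0 + 2 + n = (n + 1) + 1 by omega, contFrac_convs_succ ha,
      contFrac_convs_succ fun n => ha (n + 1), h0]
    simp only [zero_add, h1, branch, Function.iterate_zero, id]
    norm_num
    ring_nf
  | succ k ih =>
    have h0 : a 0 = 1 := by rw [h 0 (by omega), word_succ]; rfl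
    rw [show k + 1 + 2 + n = (k + 2 + n) + 1 by omega, contFrac_convs_succ ha, branch_succ,
      ih (fun n => ha (n + 1)), h0, Nat.cast_one]
    · rw [show (fun i => a (k + 1 + 2 + i)) = fun i => a (k + 2 + i + 1) from
        funext fun i => congrArg a (by omega)]
    · intro n hn
      rw [h (n + 1) (by omega), word_succ]
      rfl

theorem concat_word_pos (ω : ℕ → ℕ) (n : ℕ) : 0 < concat (fun i => word (ω i)) n := by
  have hl := le_length_flatMap_range (fun i => word_ne_nil (ω i)) (n + 1)
  rw [concat, List.getD_eq_getElem _ _ (by omega)]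
  obtain ⟨i, -, hi⟩ := List.mem_flatMap.1
    (List.getElem_mem (l := (List.range (n + 1)).flatMap fun i => word (ω i)) (n := n) (by omega))
  exact mem_word_pos hi

theorem convs_concat_word (ω : ℕ → ℕ) (n : ℕ) :
    (contFrac (concat fun i => word (ω i))).convs (ω 0 + 2 + n) =
      branch (ω 0) ((contFrac (concat fun i => word (ω (i + 1)))).convs n) := by
  have hne : ∀ i, word (ω i) ≠ [] := fun i => word_ne_nil _
  rw [convs_of_word_prefix (concat_word_pos ω)]
  · congr! 4 with i
    have := concat_length_add hne i
    rwa [length_word] at this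
  · intro m hm
    exact concat_of_lt (by rwa [length_word])

/-! ### Contraction estimates -/

/-- The square `φ⁻²` of the inverse golden ratio. -/
noncomputable def rho : ℝ := ((3 + Real.sqrt 5) / 2)⁻¹

theorem rho_eq : rho = (Real.goldenRatio ^ 2)⁻¹ := by
  rw [rho, Real.goldenRatio_sq, Real.goldenRatio]
  ring_nf

theorem rho_pos : 0 < rho := by unfold rho; positivity

theorem rho_lt_one : rho < 1 := by
  unfold rho
  apply inv_lt_one_of_one_lt₀
  have := Real.sqrt_nonneg 5
  linarith

theorem rho_pow_eq (k : ℕ) : rho ^ k = 1 / (Real.goldenRatio ^ k * Real.goldenRatio ^ k) := by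
  rw [rho_eq, inv_pow, ← pow_mul, mul_comm 2 k, one_div, mul_two, pow_add]

/-- The denominator of `y ↦ [0; 1, …, 1 + y]` with `k` letters `1`. -/
noncomputable def onesDenom (k : ℕ) (y : ℝ) : ℝ := Nat.fib (k + 1) + Nat.fib k * y

theorem onesDenom_zero (y : ℝ) : onesDenom 0 y = 1 := by simp [onesDenom]

theorem onesDenom_one (y : ℝ) : onesDenom 1 y = 1 + y := by simp [onesDenom]

theorem onesDenom_add_two (k : ℕ) (y : ℝ) :
    onesDenom (k + 2) y = onesDenom k y + onesDenom (k + 1) y := by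
  simp only [onesDenom]
  rw [Nat.fib_add_two (n := k + 1), Nat.fib_add_two (n := k)]
  push_cast
  ring

theorem onesDenom_pos {y : ℝ} (hy : 0 ≤ y) (k : ℕ) : 0 < onesDenom k y := by
  have : (0 : ℝ) < Nat.fib (k + 1) := by exact_mod_cast Nat.fib_pos.2 k.succ_pos
  unfold onesDenom
  positivity

/-- The denominators and the powers of the golden ratio satisfy the same Fibonacci recursion, so a
comparison at `k = 0, 1` propagates. -/
theorem onesDenom_bounds {y : ℝ} (hy : y ∈ Set.Icc (0 : ℝ) 1) (k : ℕ) :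
    Real.goldenRatio ^ k ≤ Real.goldenRatio * onesDenom k y ∧
      onesDenom k y ≤ Real.goldenRatio * Real.goldenRatio ^ k := by
  have h1 := Real.one_lt_goldenRatio
  have h2 := Real.goldenRatio_sq
  obtain ⟨h3, h4⟩ := hy
  induction k using Nat.twoStepInduction with
  | zero => simp [onesDenom_zero, h1.le]
  | one => rw [onesDenom_one]; constructor <;> nlinarith
  | more k ih ih' =>
    have := Real.goldenRatio_pow_sub_goldenRatio_pow k
    rw [onesDenom_add_two, eq_add_of_sub_eq this, mul_add, mul_add]
    exact ⟨add_le_add ih.1 ih'.1, add_le_add ih.2 ih'.2⟩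

theorem one_add_iterate {y : ℝ} (hy : 0 ≤ y) (k : ℕ) :
    1 + (fun z : ℝ => 1 / (1 + z))^[k] y = onesDenom (k + 1) y / onesDenom k y := by
  induction k with
  | zero => simp [onesDenom_zero, onesDenom_one]
  | succ k ih =>
    rw [Function.iterate_succ_apply', ih, onesDenom_add_two]
    have := (onesDenom_pos hy k).ne'
    have := (onesDenom_pos hy (k + 1)).ne'
    field_simp
    ring

theorem abs_one_div_add_sub {a y z : ℝ} (hy : 0 < a + y) (hz : 0 < a + z) :
    |1 / (a + y) - 1 / (a + z)| = |y - z| / ((a + y) * (a + z)) := by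
  rw [div_sub_div _ _ hy.ne' hz.ne', abs_div, abs_of_pos (mul_pos hy hz), abs_sub_comm y z]
  ring_nf

theorem abs_iterate_sub {y z : ℝ} (hy : 0 ≤ y) (hz : 0 ≤ z) (k : ℕ) :
    |(fun z : ℝ => 1 / (1 + z))^[k] y - (fun z : ℝ => 1 / (1 + z))^[k] z| =
      |y - z| / (onesDenom k y * onesDenom k z) := by
  induction k with
  | zero => simp [onesDenom_zero]
  | succ k ih =>
    have h1 := onesDenom_pos hy k
    have h2 := onesDenom_pos hy (k + 1)
    have h3 := onesDenom_pos hz k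
    have h4 := onesDenom_pos hz (k + 1)
    rw [Function.iterate_succ_apply', Function.iterate_succ_apply', abs_one_div_add_sub, ih,
      one_add_iterate hy, one_add_iterate hz]
    · field_simp
    · rw [one_add_iterate hy]; positivity
    · rw [one_add_iterate hz]; positivity

theorem iterate_mem_Icc {y : ℝ} (hy : y ∈ Set.Icc (0 : ℝ) 1) (k : ℕ) :
    (fun z : ℝ => 1 / (1 + z))^[k] y ∈ Set.Icc (0 : ℝ) 1 := by
  induction k with
  | zero => exact hy
  | succ k ih =>
    rw [Function.iterate_succ_apply']
    obtain ⟨h0, h1⟩ := ih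
    refine ⟨by positivity, ?_⟩
    rw [div_le_one (by positivity)]
    linarith

theorem rho_pow_mul_le_abs_iterate_sub {y z : ℝ} (hy : y ∈ Set.Icc (0 : ℝ) 1)
    (hz : z ∈ Set.Icc (0 : ℝ) 1) (k : ℕ) :
    rho ^ (k + 1) * |y - z| ≤
      |(fun z : ℝ => 1 / (1 + z))^[k] y - (fun z : ℝ => 1 / (1 + z))^[k] z| := by
  have h1 := onesDenom_pos hy.1 k
  have h2 := onesDenom_pos hz.1 k
  rw [abs_iterate_sub hy.1 hz.1, rho_pow_eq, div_mul_eq_mul_div, one_mul, pow_succ']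
  gcongr
  · exact (onesDenom_bounds hy k).2
  · exact (onesDenom_bounds hz k).2

theorem abs_iterate_sub_le {y z : ℝ} (hy : y ∈ Set.Icc (0 : ℝ) 1)
    (hz : z ∈ Set.Icc (0 : ℝ) 1) (k : ℕ) :
    |(fun z : ℝ => 1 / (1 + z))^[k] y - (fun z : ℝ => 1 / (1 + z))^[k] z| ≤
      4 * rho ^ k * |y - z| := by
  have h1 := onesDenom_pos hy.1 k
  have h2 := onesDenom_pos hz.1 k
  have hp := Real.goldenRatio_pos
  have hk : (0 : ℝ) < Real.goldenRatio ^ k := by positivity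
  have h3 := (onesDenom_bounds hy k).1
  have h4 := (onesDenom_bounds hz k).1
  have h5 : Real.goldenRatio ^ k * Real.goldenRatio ^ k ≤
      4 * (onesDenom k y * onesDenom k z) := by
    calc _ ≤ (Real.goldenRatio * onesDenom k y) * (Real.goldenRatio * onesDenom k z) := by gcongr
      _ = Real.goldenRatio ^ 2 * (onesDenom k y * onesDenom k z) := by ring
      _ ≤ _ := by
        gcongr
        nlinarith [Real.goldenRatio_lt_two]
  rw [abs_iterate_sub hy.1 hz.1, rho_pow_eq, div_le_iff₀ (by positivity)]
  have h6 : 1 ≤ 4 * (1 / (Real.goldenRatio ^ k * Real.goldenRatio ^ k)) *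
      (onesDenom k y * onesDenom k z) := by
    rw [mul_one_div, div_mul_eq_mul_div, le_div_iff₀ (by positivity), one_mul]
    exact h5
  nlinarith [abs_nonneg (y - z)]

theorem twos_mem_Icc {y : ℝ} (hy : y ∈ Set.Icc (0 : ℝ) 1) :
    1 / (2 + 1 / (2 + y)) ∈ Set.Icc (0 : ℝ) (3 / 7) := by
  obtain ⟨h0, h1⟩ := hy
  refine ⟨by positivity, ?_⟩
  have h2 : 1 / 3 ≤ 1 / (2 + y) := by gcongr; linarith
  calc 1 / (2 + 1 / (2 + y)) ≤ 1 / (2 + 1 / 3) := by gcongr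
    _ = 3 / 7 := by norm_num

theorem twos_mem_Icc_one {y : ℝ} (hy : y ∈ Set.Icc (0 : ℝ) 1) :
    1 / (2 + 1 / (2 + y)) ∈ Set.Icc (0 : ℝ) 1 :=
  Set.Icc_subset_Icc_right (by norm_num) (twos_mem_Icc hy)

theorem abs_twos_sub {y z : ℝ} (hy : y ∈ Set.Icc (0 : ℝ) 1) (hz : z ∈ Set.Icc (0 : ℝ) 1) :
    |y - z| / 81 ≤ |1 / (2 + 1 / (2 + y)) - 1 / (2 + 1 / (2 + z))| ∧
      |1 / (2 + 1 / (2 + y)) - 1 / (2 + 1 / (2 + z))| ≤ |y - z| / 16 := by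
  obtain ⟨h0, h1⟩ := hy
  obtain ⟨h2, h3⟩ := hz
  rw [abs_one_div_add_sub (by positivity) (by positivity),
    abs_one_div_add_sub (by positivity) (by positivity), div_div]
  have e : (2 + y) * (2 + z) * ((2 + 1 / (2 + y)) * (2 + 1 / (2 + z))) =
      (5 + 2 * y) * (5 + 2 * z) := by
    have : 2 + y ≠ 0 := by positivity
    have : 2 + z ≠ 0 := by positivity
    field_simp
    ring
  -- For `y, z` in `[0, 1]` this product lies between 25 and 49, hence between 16 and 81.
  rw [e]
  constructor <;> gcongr <;> nlinarith

/-- Absorbs the loss from the letters `22` into five more powers of `rho`; with the one lost on the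
block of ones this gives the shift 6 in `le_abs_branch_sub`. -/
theorem rho_pow_five_le : rho ^ 5 ≤ 1 / 81 := by
  have h : rho ≤ 5 / 13 := by
    unfold rho
    rw [inv_le_comm₀ (by positivity) (by norm_num)]
    have : (11 / 5 : ℝ) ≤ Real.sqrt 5 := Real.le_sqrt_of_sq_le (by norm_num)
    linarith
  calc rho ^ 5 ≤ (5 / 13) ^ 5 := pow_le_pow_left₀ rho_pos.le h 5
    _ ≤ 1 / 81 := by norm_num

theorem branch_mem_Icc {y : ℝ} (hy : y ∈ Set.Icc (0 : ℝ) 1) (k : ℕ) :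
    branch k y ∈ Set.Icc (0 : ℝ) 1 :=
  iterate_mem_Icc (twos_mem_Icc_one hy) k

theorem le_abs_branch_sub {y z : ℝ} (hy : y ∈ Set.Icc (0 : ℝ) 1) (hz : z ∈ Set.Icc (0 : ℝ) 1)
    (k : ℕ) : rho ^ (k + 6) * |y - z| ≤ |branch k y - branch k z| := by
  refine le_trans ?_ (rho_pow_mul_le_abs_iterate_sub (twos_mem_Icc_one hy) (twos_mem_Icc_one hz) k)
  have := (abs_twos_sub hy hz).1
  have h := rho_pow_five_le
  have hp : 0 < rho ^ (k + 1) := pow_pos rho_pos _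
  calc rho ^ (k + 6) * |y - z| = rho ^ (k + 1) * (rho ^ 5 * |y - z|) := by ring
    _ ≤ rho ^ (k + 1) * (1 / 81 * |y - z|) := by gcongr
    _ ≤ _ := by gcongr; linarith

theorem abs_branch_sub_le {y z : ℝ} (hy : y ∈ Set.Icc (0 : ℝ) 1) (hz : z ∈ Set.Icc (0 : ℝ) 1)
    (k : ℕ) : |branch k y - branch k z| ≤ rho ^ k / 2 * |y - z| := by
  refine (abs_iterate_sub_le (twos_mem_Icc_one hy) (twos_mem_Icc_one hz) k).trans ?_
  have := (abs_twos_sub hy hz).2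
  have hp : 0 < rho ^ k := pow_pos rho_pos _
  have := abs_nonneg (y - z)
  calc _ ≤ 4 * rho ^ k * (|y - z| / 16) := by gcongr
    _ ≤ _ := by nlinarith [mul_nonneg hp.le this]

/-- After the `k` common letters 1 are stripped, one point starts with the digit 2 and is at most `3
/ 7`, the other starts with 1 and is at least `1 / 2`. The gap `1 / 14` is then carried through the
common block. -/
theorem branch_gap {y z : ℝ} (hy : y ∈ Set.Icc (0 : ℝ) 1) (hz : z ∈ Set.Icc (0 : ℝ) 1)
    {k l : ℕ} (h : k < l) : rho ^ (k + 1) / 14 ≤ |branch k y - branch l z| := by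
  obtain ⟨m, rfl⟩ := Nat.exists_eq_add_of_lt h
  have e : branch (k + m + 1) z = (fun z : ℝ => 1 / (1 + z))^[k] (1 / (1 + branch m z)) := by
    rw [← branch_succ, branch, branch, ← Function.iterate_add_apply, add_assoc]
  have hm := branch_mem_Icc hz m
  have hm' := branch_mem_Icc hz (m + 1)
  rw [branch_succ] at hm'
  have hy' := twos_mem_Icc hy
  have h2 : 1 / 2 ≤ 1 / (1 + branch m z) := by
    have := hm.1
    gcongr
    linarith [hm.2]
  rw [e]
  refine le_trans ?_ (rho_pow_mul_le_abs_iterate_sub (twos_mem_Icc_one hy) hm' k)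
  have : 1 / 14 ≤ |1 / (2 + 1 / (2 + y)) - 1 / (1 + branch m z)| := by
    rw [abs_sub_comm]
    exact le_trans (by linarith [hy'.2]) (le_abs_self _)
  have hp : 0 < rho ^ (k + 1) := pow_pos rho_pos _
  nlinarith

/-! ### Compositions of branches and the coding map -/

/-- The composition `branch (ω 0) ∘ ⋯ ∘ branch (ω (n - 1))`. -/
noncomputable def branchComp : ℕ → (ℕ → ℕ) → ℝ → ℝ
  | 0, _, y => y
  | n + 1, ω, y => branch (ω 0) (branchComp n (fun i => ω (i + 1)) y)

theorem branchComp_mem_Icc {y : ℝ} (hy : y ∈ Set.Icc (0 : ℝ) 1) (n : ℕ) (ω : ℕ → ℕ) :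
    branchComp n ω y ∈ Set.Icc (0 : ℝ) 1 := by
  induction n generalizing ω with
  | zero => exact hy
  | succ n ih => exact branch_mem_Icc (ih _) _

theorem branchComp_succ_right (n : ℕ) (ω : ℕ → ℕ) (y : ℝ) :
    branchComp (n + 1) ω y = branchComp n ω (branch (ω n) y) := by
  induction n generalizing ω with
  | zero => rfl
  | succ n ih => exact congrArg _ (ih fun i => ω (i + 1))

theorem branchComp_congr {n : ℕ} {ω ω' : ℕ → ℕ} (h : ∀ i < n, ω i = ω' i) (y : ℝ) :
    branchComp n ω y = branchComp n ω' y := by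
  induction n generalizing ω ω' with
  | zero => rfl
  | succ n ih =>
    rw [branchComp, branchComp, h 0 n.succ_pos, ih fun i hi => h (i + 1) (by omega)]

theorem prod_mul_le_abs_branchComp_sub {y z : ℝ} (hy : y ∈ Set.Icc (0 : ℝ) 1)
    (hz : z ∈ Set.Icc (0 : ℝ) 1) (n : ℕ) (ω : ℕ → ℕ) :
    (∏ i ∈ Finset.range n, rho ^ (ω i + 6)) * |y - z| ≤
      |branchComp n ω y - branchComp n ω z| := by
  induction n generalizing ω with
  | zero => simp [branchComp]
  | succ n ih =>
    refine le_trans ?_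
      (le_abs_branch_sub (branchComp_mem_Icc hy n _) (branchComp_mem_Icc hz n _) (ω 0))
    rw [Finset.prod_range_succ', mul_comm (∏ i ∈ _, _), mul_assoc]
    exact mul_le_mul_of_nonneg_left (ih _) (pow_pos rho_pos _).le

theorem abs_branchComp_sub_le {y z : ℝ} (hy : y ∈ Set.Icc (0 : ℝ) 1)
    (hz : z ∈ Set.Icc (0 : ℝ) 1) (n : ℕ) (ω : ℕ → ℕ) :
    |branchComp n ω y - branchComp n ω z| ≤
      (∏ i ∈ Finset.range n, rho ^ ω i / 2) * |y - z| := by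
  induction n generalizing ω with
  | zero => simp [branchComp]
  | succ n ih =>
    refine (abs_branch_sub_le (branchComp_mem_Icc hy n _)
      (branchComp_mem_Icc hz n _) (ω 0)).trans ?_
    rw [Finset.prod_range_succ', mul_comm (∏ i ∈ _, _), mul_assoc]
    exact mul_le_mul_of_nonneg_left (ih _) (by have := pow_pos rho_pos (ω 0); positivity)

theorem abs_sub_le_one_of_mem_Icc {y z : ℝ} (hy : y ∈ Set.Icc (0 : ℝ) 1)
    (hz : z ∈ Set.Icc (0 : ℝ) 1) : |y - z| ≤ 1 := by
  rw [abs_le]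
  constructor <;> linarith [hy.1, hy.2, hz.1, hz.2]

theorem abs_branchComp_sub_le_prod {y z : ℝ} (hy : y ∈ Set.Icc (0 : ℝ) 1)
    (hz : z ∈ Set.Icc (0 : ℝ) 1) (n : ℕ) (ω : ℕ → ℕ) :
    |branchComp n ω y - branchComp n ω z| ≤ ∏ i ∈ Finset.range n, rho ^ ω i := by
  refine (abs_branchComp_sub_le hy hz n ω).trans ?_
  have h0 : ∀ i, 0 < rho ^ ω i := fun i => pow_pos rho_pos _
  calc _ ≤ (∏ i ∈ Finset.range n, rho ^ ω i) * 1 := by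
        refine mul_le_mul (Finset.prod_le_prod (fun i _ => (half_pos (h0 i)).le)
          fun i _ => half_le_self (h0 i).le) (abs_sub_le_one_of_mem_Icc hy hz) (abs_nonneg _)
          (Finset.prod_nonneg fun i _ => (h0 i).le)
    _ = _ := mul_one _

theorem abs_branchComp_sub_le_half_pow {y z : ℝ} (hy : y ∈ Set.Icc (0 : ℝ) 1)
    (hz : z ∈ Set.Icc (0 : ℝ) 1) (n : ℕ) (ω : ℕ → ℕ) :
    |branchComp n ω y - branchComp n ω z| ≤ (1 / 2) ^ n := by
  refine (abs_branchComp_sub_le hy hz n ω).trans ?_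
  have h0 : ∀ i, 0 < rho ^ ω i := fun i => pow_pos rho_pos _
  have h1 : ∀ i, rho ^ ω i ≤ 1 := fun i => pow_le_one₀ rho_pos.le rho_lt_one.le
  calc _ ≤ (∏ _i ∈ Finset.range n, (1 / 2 : ℝ)) * 1 := by
        refine mul_le_mul (Finset.prod_le_prod (fun i _ => (half_pos (h0 i)).le)
          fun i _ => ?_) (abs_sub_le_one_of_mem_Icc hy hz) (abs_nonneg _)
          (Finset.prod_nonneg fun i _ => by norm_num)
        linarith [h1 i]
    _ = _ := by simp

theorem zero_mem_Icc_zero_one : (0 : ℝ) ∈ Set.Icc (0 : ℝ) 1 := by simp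

/-- The point whose continued fraction expansion is `1^(ω 0) 22 1^(ω 1) 22 ⋯`. -/
noncomputable def codePoint (ω : ℕ → ℕ) : ℝ :=
  limUnder atTop fun n => branchComp n ω 0

theorem tendsto_branchComp (ω : ℕ → ℕ) :
    Tendsto (fun n => branchComp n ω 0) atTop (𝓝 (codePoint ω)) := by
  have h : CauchySeq fun n => branchComp n ω 0 := by
    refine cauchySeq_of_le_geometric (1 / 2) 1 (by norm_num) fun n => ?_
    rw [branchComp_succ_right, Real.dist_eq, one_mul]
    exact abs_branchComp_sub_le_half_pow zero_mem_Icc_zero_one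
      (branch_mem_Icc zero_mem_Icc_zero_one _) n ω
  exact h.tendsto_limUnder

theorem codePoint_mem_Icc (ω : ℕ → ℕ) : codePoint ω ∈ Set.Icc (0 : ℝ) 1 :=
  isClosed_Icc.mem_of_tendsto (tendsto_branchComp ω)
    (Eventually.of_forall fun n => branchComp_mem_Icc zero_mem_Icc_zero_one n ω)

theorem codePoint_eq_branch (ω : ℕ → ℕ) :
    codePoint ω = branch (ω 0) (codePoint fun i => ω (i + 1)) := by
  refine tendsto_nhds_unique ((tendsto_branchComp ω).comp (tendsto_add_atTop_nat 1)) ?_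
  have hc : ContinuousOn (branch (ω 0)) (Set.Icc 0 1) := by
    refine LipschitzOnWith.continuousOn (K := 1) (LipschitzOnWith.of_dist_le_mul ?_)
    intro y hy z hz
    refine (abs_branch_sub_le hy hz _).trans ?_
    have h1 : rho ^ ω 0 ≤ 1 := pow_le_one₀ rho_pos.le rho_lt_one.le
    rw [NNReal.coe_one, Real.dist_eq]
    exact mul_le_mul_of_nonneg_right (by linarith) (abs_nonneg _)
  exact (hc _ (codePoint_mem_Icc _)).tendsto.comp (tendsto_nhdsWithin_iff.2
    ⟨tendsto_branchComp fun i => ω (i + 1),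
      Eventually.of_forall fun n => branchComp_mem_Icc zero_mem_Icc_zero_one n _⟩)

theorem codePoint_eq_branchComp (n : ℕ) (ω : ℕ → ℕ) :
    codePoint ω = branchComp n ω (codePoint fun i => ω (n + i)) := by
  induction n generalizing ω with
  | zero => simp [branchComp]
  | succ n ih =>
    rw [codePoint_eq_branch, ih, branchComp]
    simp only [add_assoc, add_comm 1]

/-- All late convergents lie in one cylinder of level `n`, whose diameter is at most `2⁻ⁿ`;
convergence to `codePoint ω` follows. -/
theorem exists_convs_eq_branchComp (n : ℕ) (ω : ℕ → ℕ) :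
    ∃ N, ∀ m, ∃ y ∈ Set.Icc (0 : ℝ) 1,
      (contFrac (concat fun i => word (ω i))).convs (N + m) = branchComp n ω y := by
  induction n generalizing ω with
  | zero => exact ⟨0, fun m => ⟨_, contFrac_convs_mem_Icc (concat_word_pos ω) _, rfl⟩⟩
  | succ n ih =>
    obtain ⟨N, hN⟩ := ih fun i => ω (i + 1)
    refine ⟨ω 0 + 2 + N, fun m => ?_⟩
    obtain ⟨y, hy, h⟩ := hN m
    exact ⟨y, hy, by rw [add_assoc, convs_concat_word, h, branchComp]⟩

theorem hasContFrac_codePoint (ω : ℕ → ℕ) :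
    HasContFrac (codePoint ω) (concat fun i => word (ω i)) := by
  refine Metric.tendsto_atTop.2 fun ε hε => ?_
  obtain ⟨n, hn⟩ := exists_pow_lt_of_lt_one hε (show (1 / 2 : ℝ) < 1 by norm_num)
  obtain ⟨N, hN⟩ := exists_convs_eq_branchComp n ω
  refine ⟨N, fun m hm => ?_⟩
  obtain ⟨k, rfl⟩ := Nat.exists_eq_add_of_le hm
  obtain ⟨y, hy, h⟩ := hN k
  rw [h, codePoint_eq_branchComp n ω, Real.dist_eq]
  exact (abs_branchComp_sub_le_half_pow hy (codePoint_mem_Icc _) n ω).trans_lt hn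

theorem mem_gaussCantor_alphabet {r : ℕ} {s : ℕ∞} {x : ℝ} :
    x ∈ gaussCantor (alphabet r s) ↔
      ∃ ω : ℕ → ℕ, (∀ i, (ω i : ℕ∞) ≤ s) ∧ codePoint (fun i => r + ω i) = x := by
  constructor
  · rintro ⟨γ, hγ, hx⟩
    choose ω hω hγω using hγ
    obtain rfl : γ = fun i => word (r + ω i) := funext hγω
    exact ⟨ω, hω, tendsto_nhds_unique (hasContFrac_codePoint fun i => r + ω i) hx⟩
  · rintro ⟨ω, hω, rfl⟩
    exact ⟨fun i => word (r + ω i), fun i => ⟨ω i, hω i, rfl⟩, hasContFrac_codePoint _⟩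

theorem gaussCantor_alphabet_mono (r : ℕ) {s t : ℕ∞} (h : s ≤ t) :
    gaussCantor (alphabet r s) ⊆ gaussCantor (alphabet r t) := by
  rintro x ⟨γ, hγ, hx⟩
  refine ⟨γ, fun i => ?_, hx⟩
  obtain ⟨j, hj, hw⟩ := hγ i
  exact ⟨j, hj.trans h, hw⟩

/-! ### The upper bound for the dimension -/

theorem tsum_prod_fin_eq_pow (f : ℕ → ENNReal) (n : ℕ) :
    ∑' v : Fin n → ℕ, ∏ i, f (v i) = (∑' j, f j) ^ n := by
  induction n with
  | zero => simp
  | succ n ih =>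
    rw [← (Fin.consEquiv fun _ => ℕ).tsum_eq, ENNReal.tsum_prod', pow_succ', ← ih,
      ← ENNReal.tsum_mul_right]
    refine tsum_congr fun j => ?_
    rw [← ENNReal.tsum_mul_left]
    refine tsum_congr fun v => ?_
    rw [Fin.prod_univ_succ]
    simp [Fin.consEquiv]

theorem dimH_gaussCantor_le {r : ℕ} {D : NNReal}
    (h : ∑' j : ℕ, ENNReal.ofReal (rho ^ (r + j)) ^ (D : ℝ) ≤ 1) (s : ℕ∞) :
    dimH (gaussCantor (alphabet r s)) ≤ D := by
  apply dimH_le_of_hausdorffMeasure_ne_top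
  -- The letters run over all of `ℕ` whatever `s` is, so the sum over level-`n` cylinders is bounded
  -- by the `n`-th power of a single series. The padding value 0 is never read by `branchComp n`.
  set code : ∀ n : ℕ, (Fin n → ℕ) → ℕ → ℕ :=
    fun n v i => if h : i < n then r + v ⟨i, h⟩ else 0 with hcode
  set t : ∀ n : ℕ, (Fin n → ℕ) → Set ℝ :=
    fun n v => branchComp n (code n v) '' Set.Icc 0 1 with ht
  have hdiam : ∀ n v, Metric.ediam (t n v) ≤ ∏ i : Fin n, ENNReal.ofReal (rho ^ (r + v i)) := by
    intro n v
    refine Metric.ediam_le ?_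
    rintro _ ⟨y, hy, rfl⟩ _ ⟨z, hz, rfl⟩
    rw [edist_dist, Real.dist_eq, ← ENNReal.ofReal_prod_of_nonneg
      fun i _ => (pow_pos rho_pos _).le]
    refine ENNReal.ofReal_le_ofReal ((abs_branchComp_sub_le_prod hy hz n _).trans_eq ?_)
    rw [← Fin.prod_univ_eq_prod_range (fun i => rho ^ code n v i)]
    simp [hcode]
  have hhalf : ∀ n v, Metric.ediam (t n v) ≤ ENNReal.ofReal ((1 / 2) ^ n) := by
    intro n v
    refine Metric.ediam_le ?_
    rintro _ ⟨y, hy, rfl⟩ _ ⟨z, hz, rfl⟩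
    rw [edist_dist, Real.dist_eq]
    exact ENNReal.ofReal_le_ofReal (abs_branchComp_sub_le_half_pow hy hz n _)
  have hlim : Tendsto (fun n : ℕ => ENNReal.ofReal ((1 / 2) ^ n)) atTop (𝓝 0) := by
    rw [← ENNReal.ofReal_zero]
    exact ENNReal.tendsto_ofReal (tendsto_pow_atTop_nhds_zero_of_lt_one (by norm_num) (by norm_num))
  have hcover : ∀ n, gaussCantor (alphabet r s) ⊆ ⋃ v, t n v := by
    intro n x hx
    obtain ⟨ω, -, rfl⟩ := mem_gaussCantor_alphabet.1 hx
    refine Set.mem_iUnion.2 ⟨fun i => ω i, ?_⟩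
    rw [codePoint_eq_branchComp n]
    refine ⟨_, codePoint_mem_Icc _, branchComp_congr (fun i hi => ?_) _⟩
    simp [hcode, hi]
  have key := MeasureTheory.Measure.hausdorffMeasure_le_liminf_tsum (D : ℝ)
    (gaussCantor (alphabet r s)) (l := atTop) _ hlim t
    (Eventually.of_forall hhalf) (Eventually.of_forall hcover)
  refine ne_top_of_le_ne_top ENNReal.one_ne_top (key.trans ?_)
  refine (liminf_le_liminf (Eventually.of_forall fun n => ?_)).trans_eq
    (liminf_const (1 : ENNReal))
  calc ∑' v, Metric.ediam (t n v) ^ (D : ℝ)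
      ≤ ∑' v : Fin n → ℕ, ∏ i, ENNReal.ofReal (rho ^ (r + v i)) ^ (D : ℝ) := by
        refine ENNReal.tsum_le_tsum fun v => ?_
        rw [ENNReal.prod_rpow_of_nonneg D.coe_nonneg]
        exact ENNReal.rpow_le_rpow (hdiam n v) D.coe_nonneg
    _ = (∑' j : ℕ, ENNReal.ofReal (rho ^ (r + j)) ^ (D : ℝ)) ^ n :=
        tsum_prod_fin_eq_pow (fun j => ENNReal.ofReal (rho ^ (r + j)) ^ (D : ℝ)) n
    _ ≤ 1 := pow_le_one₀ zero_le h

/-! ### The lower bound for the dimension -/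

section Lower

open MeasureTheory

theorem measurable_branch (k : ℕ) : Measurable (branch k) := by
  unfold branch
  have h : Measurable fun z : ℝ => 1 / (1 + z) := by fun_prop
  exact (h.iterate k).comp (by fun_prop)

theorem measurable_branchComp {N : ℕ} (r n m : ℕ) :
    Measurable fun ω : ℕ → Fin N => branchComp n (fun i => r + ω (i + m)) 0 := by
  induction n generalizing m with
  | zero => exact measurable_const
  | succ n ih =>
    have h : Measurable fun q : Fin N × ℝ => branch (r + q.1) q.2 :=
      measurable_from_prod_countable_right fun j => measurable_branch (r + j)
    have := h.comp ((measurable_pi_apply (0 + m)).prodMk (ih (m + 1)))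
    convert this using 4
    simp only [branchComp, Function.comp, add_assoc, add_comm 1 m]

theorem measurable_codePoint {N : ℕ} (r : ℕ) :
    Measurable fun ω : ℕ → Fin N => codePoint fun i => r + ω i :=
  measurable_of_tendsto_metrizable (fun n => measurable_branchComp r n 0)
    (tendsto_pi_nhds.2 fun ω => tendsto_branchComp fun i => r + ω i)

/-- The branches differ at position `n`, so `branch_gap` applies there, and the common prefix
shrinks that gap by at most the product of the lower contraction factors. -/
theorem codePoint_separation {r s n : ℕ} {ω ω' : ℕ → ℕ} (hω : ω n ≤ r + s) (hω' : ω' n ≤ r + s)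
    (heq : ∀ i < n, ω i = ω' i) (hne : ω n ≠ ω' n) :
    rho ^ (r + s + 1) / 14 * ∏ i ∈ Finset.range n, rho ^ (ω i + 6) ≤
      |codePoint ω - codePoint ω'| := by
  have key : ∀ {a b : ℕ} {y z : ℝ}, y ∈ Set.Icc (0 : ℝ) 1 → z ∈ Set.Icc (0 : ℝ) 1 → a < b →
      b ≤ r + s → rho ^ (r + s + 1) / 14 ≤ |branch a y - branch b z| := by
    intro a b y z hy hz hab hb
    refine le_trans ?_ (branch_gap hy hz hab)
    have := pow_le_pow_of_le_one rho_pos.le rho_lt_one.le (show a + 1 ≤ r + s + 1 by omega)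
    linarith
  rw [codePoint_eq_branchComp n ω, codePoint_eq_branchComp n ω', ← branchComp_congr heq]
  refine le_trans ?_ (prod_mul_le_abs_branchComp_sub (codePoint_mem_Icc _) (codePoint_mem_Icc _) n ω)
  rw [mul_comm]
  refine mul_le_mul_of_nonneg_left ?_ (Finset.prod_nonneg fun i _ => (pow_pos rho_pos _).le)
  rw [codePoint_eq_branch, codePoint_eq_branch fun i => ω' (n + i)]
  rcases lt_or_gt_of_ne hne with h | h
  · exact key (codePoint_mem_Icc _) (codePoint_mem_Icc _) h hω'
  · rw [abs_sub_comm]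
    exact key (codePoint_mem_Icc _) (codePoint_mem_Icc _) h hω

theorem infinitePi_prefix_le {N : ℕ} (P : Measure (Fin N)) [IsProbabilityMeasure P]
    {w : Fin N → ENNReal} (hP : ∀ j, P {j} ≤ w j) {V : Set (ℕ → Fin N)} {n : ℕ} {ω : ℕ → Fin N}
    (hV : ∀ ω' ∈ V, ∀ i < n, ω' i = ω i) :
    Measure.infinitePi (fun _ : ℕ => P) V ≤ ∏ i ∈ Finset.range n, w (ω i) := by
  calc Measure.infinitePi (fun _ : ℕ => P) V
      ≤ Measure.infinitePi (fun _ : ℕ => P)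
          (Set.pi (Finset.range n : Set ℕ) fun i => {ω i}) :=
        measure_mono fun ω' h' i hi => hV ω' h' i (Finset.mem_range.1 hi)
    _ = ∏ i ∈ Finset.range n, P {ω i} :=
        Measure.infinitePi_pi _ fun i _ => MeasurableSet.singleton _
    _ ≤ _ := Finset.prod_le_prod' fun i _ => hP _

theorem le_dimH_gaussCantor {r s : ℕ} {D : NNReal} (hD : 0 < D)
    (h : 1 ≤ ∑ k : Fin (s + 1), ENNReal.ofReal (rho ^ (r + k + 6)) ^ (D : ℝ)) :
    D ≤ dimH (gaussCantor (alphabet r s)) := by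
  set w : Fin (s + 1) → ENNReal := fun k => ENNReal.ofReal (rho ^ (r + k + 6)) ^ (D : ℝ) with hw
  have hwtop : ∀ k, w k ≠ ⊤ := fun k => ENNReal.rpow_ne_top_of_nonneg D.coe_nonneg ENNReal.ofReal_ne_top
  have hS0 : ∑ k, w k ≠ 0 := (zero_lt_one.trans_le h).ne'
  have hStop : ∑ k, w k ≠ ⊤ := ENNReal.sum_ne_top.2 fun k _ => hwtop k
  set p : PMF (Fin (s + 1)) := PMF.ofFintype (fun k => w k / ∑ k, w k) (by
    simp only [div_eq_mul_inv]
    rw [← Finset.sum_mul, ENNReal.mul_inv_cancel hS0 hStop]) with hp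
  set P : Measure (Fin (s + 1)) := p.toMeasure with hPdef
  have hP : ∀ j, P {j} ≤ w j := by
    intro j
    rw [hPdef, PMF.toMeasure_apply_singleton _ _ (MeasurableSet.singleton j), hp,
      PMF.ofFintype_apply]
    -- Normalising divides by a sum that is at least 1, so it only lowers the weights.
    exact ENNReal.div_le_of_le_mul (le_mul_of_one_le_right zero_le h)
  set ν : Measure (ℕ → Fin (s + 1)) := Measure.infinitePi fun _ : ℕ => P with hν
  set π : (ℕ → Fin (s + 1)) → ℝ := fun ω => codePoint fun i => r + ω i with hπ
  have hπm : Measurable π := measurable_codePoint r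
  set g : ℝ := rho ^ (r + s + 1) / 14 with hg
  have hg0 : 0 < g := by have := pow_pos rho_pos (r + s + 1); positivity
  set c : ENNReal := ENNReal.ofReal g ^ (D : ℝ) with hc
  have hwlt : ∃ θ < (1 : ENNReal), ∀ k, w k ≤ θ := by
    refine ⟨ENNReal.ofReal rho ^ (D : ℝ), ENNReal.rpow_lt_one ?_ (NNReal.coe_pos.2 hD), fun k => ?_⟩
    · exact ENNReal.ofReal_lt_one.2 rho_lt_one
    · exact ENNReal.rpow_le_rpow (ENNReal.ofReal_le_ofReal
        (pow_le_of_le_one rho_pos.le rho_lt_one.le (by omega))) D.coe_nonneg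
  have hmass : ∀ U : Set ℝ, c * ν (π ⁻¹' U) ≤ Metric.ediam U ^ (D : ℝ) := by
    intro U
    rcases (π ⁻¹' U).eq_empty_or_nonempty with hV | ⟨ω₀, hω₀⟩
    · rw [hV]; simp
    -- If some code in the preimage departs from `ω₀`, the least such position bounds the mass from
    -- above and the diameter from below by the same product. Otherwise the preimage is one code, of
    -- mass 0.
    by_cases hex : ∃ n, ∃ ω ∈ π ⁻¹' U, ω n ≠ ω₀ n
    · classical
      obtain ⟨ω₁, hω₁, hne⟩ := Nat.find_spec hex
      set n := Nat.find hex with hn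
      have hpre : ∀ ω ∈ π ⁻¹' U, ∀ i < n, ω i = ω₀ i := by
        intro ω hω i hi
        by_contra hcon
        exact Nat.find_min hex hi ⟨ω, hω, hcon⟩
      have hsep : ENNReal.ofReal g * ∏ i ∈ Finset.range n, ENNReal.ofReal (rho ^ (r + ω₀ i + 6)) ≤
          Metric.ediam U := by
        refine le_trans ?_ (Metric.edist_le_ediam_of_mem hω₀ hω₁)
        rw [← ENNReal.ofReal_prod_of_nonneg fun i _ => (pow_pos rho_pos _).le,
          ← ENNReal.ofReal_mul hg0.le, edist_dist, Real.dist_eq]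
        refine ENNReal.ofReal_le_ofReal
          (codePoint_separation (n := n) (ω := fun i => r + ω₀ i) (ω' := fun i => r + ω₁ i)
          ?_ ?_ ?_ ?_)
        · have := (ω₀ n).is_lt; omega
        · have := (ω₁ n).is_lt; omega
        · intro i hi; simp only [hpre ω₁ hω₁ i hi]
        · intro hcon
          exact hne (Fin.ext (by omega))
      calc c * ν (π ⁻¹' U) ≤ c * ∏ i ∈ Finset.range n, w (ω₀ i) := by
            gcongr
            exact infinitePi_prefix_le P hP hpre
        _ = (ENNReal.ofReal g *
              ∏ i ∈ Finset.range n, ENNReal.ofReal (rho ^ (r + ω₀ i + 6))) ^ (D : ℝ) := by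
            rw [ENNReal.mul_rpow_of_nonneg _ _ D.coe_nonneg,
              ← ENNReal.prod_rpow_of_nonneg D.coe_nonneg]
        _ ≤ _ := ENNReal.rpow_le_rpow hsep D.coe_nonneg
    · push Not at hex
      obtain ⟨θ, hθ, hwθ⟩ := hwlt
      have hzero : ν (π ⁻¹' U) ≤ 0 := by
        refine ge_of_tendsto' (ENNReal.tendsto_pow_atTop_nhds_zero_of_lt_one hθ) fun n => ?_
        refine (infinitePi_prefix_le P hP (n := n) (ω := ω₀)
          fun ω hω i _ => hex i ω hω).trans ?_
        refine (Finset.prod_le_prod' fun i _ => hwθ (ω₀ i)).trans_eq ?_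
        simp
      rw [nonpos_iff_eq_zero.1 hzero, mul_zero]
      exact zero_le
  have hle : c • ν.map π ≤ μH[(D : ℝ)] := by
    refine Measure.le_hausdorffMeasure _ _ 1 one_pos fun U _ => ?_
    -- `U` need not be measurable; its closure is, and has the same diameter.
    calc (c • ν.map π) U ≤ (c • ν.map π) (closure U) := measure_mono subset_closure
      _ = c * ν (π ⁻¹' closure U) := by
        rw [Measure.smul_apply, Measure.map_apply hπm isClosed_closure.measurableSet, smul_eq_mul]
      _ ≤ _ := (hmass _).trans_eq (by rw [Metric.ediam_closure])
  apply le_dimH_of_hausdorffMeasure_ne_zero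
  have hone : 1 ≤ ν.map π (gaussCantor (alphabet r s)) := by
    refine le_trans ?_ (Measure.le_map_apply hπm.aemeasurable _)
    have : π ⁻¹' gaussCantor (alphabet r s) = Set.univ := by
      refine Set.eq_univ_of_forall fun ω => mem_gaussCantor_alphabet.2 ⟨fun i => ω i, fun i => ?_, rfl⟩
      exact_mod_cast Nat.lt_succ_iff.1 (ω i).is_lt
    rw [this, measure_univ]
  have hc0 : 0 < c := ENNReal.rpow_pos (ENNReal.ofReal_pos.2 hg0) ENNReal.ofReal_ne_top
  have := hle (gaussCantor (alphabet r s))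
  rw [Measure.smul_apply, smul_eq_mul] at this
  exact (hc0.trans_le ((le_mul_of_one_le_right zero_le hone).trans this)).ne'

end Lower

/-! ### Dimension bounds in terms of the pressure equation -/

/-- The exponential rate `log ((3 + √5) / 2)`. -/
noncomputable def goldenRate : ℝ := Real.log ((3 + Real.sqrt 5) / 2)

theorem goldenRate_pos : 0 < goldenRate := by
  apply Real.log_pos
  have := Real.sqrt_nonneg 5
  linarith

theorem exp_neg_c₀ : Real.exp (-c₀) = goldenRate := by
  rw [c₀, neg_neg]
  exact Real.exp_log goldenRate_pos

theorem rho_pow_eq_exp (k : ℕ) : rho ^ k = Real.exp (-(goldenRate * k)) := by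
  rw [rho, inv_pow, Real.exp_neg, mul_comm, Real.exp_nat_mul, goldenRate,
    Real.exp_log (by positivity)]

theorem ofReal_rho_pow_rpow {r : ℕ} (hr : 0 < r) {x : ℝ} (hx : 0 ≤ x) (k : ℕ) :
    ENNReal.ofReal (rho ^ k) ^ ((x / (goldenRate * r)).toNNReal : ℝ) =
      ENNReal.ofReal (Real.exp (-(x / r * k))) := by
  have h1 := goldenRate_pos
  have h2 : (0 : ℝ) < r := by exact_mod_cast hr
  rw [Real.coe_toNNReal _ (by positivity), ENNReal.ofReal_rpow_of_nonneg (pow_pos rho_pos _).le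
    (by positivity), rho_pow_eq_exp, ← Real.exp_mul]
  congr 2
  field_simp

/-- The Moran sum is `exp (-x) / (1 - exp (-x / r))`, and `1 - exp (-x / r) ≥ x / (r + x)`. -/
theorem dimH_gaussCantor_le_ofReal {r : ℕ} (hr : 0 < r) {x : ℝ} (hx : 0 < x)
    (h : r + x ≤ x * Real.exp x) (s : ℕ∞) :
    dimH (gaussCantor (alphabet r s)) ≤ ENNReal.ofReal (x / (goldenRate * r)) := by
  refine dimH_gaussCantor_le ?_ s
  have h2 : (0 : ℝ) < r := by exact_mod_cast hr
  have ht : 0 < x / r := by positivity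
  have hq1 : Real.exp (-(x / r)) < 1 := Real.exp_lt_one_iff.2 (by linarith)
  have hterm : ∀ j : ℕ, Real.exp (-(x / r * (r + j : ℕ))) =
      Real.exp (-x) * Real.exp (-(x / r)) ^ j := by
    intro j
    rw [← Real.exp_nat_mul, ← Real.exp_add]
    congr 1
    push_cast
    field_simp
    ring
  simp_rw [ofReal_rho_pow_rpow hr hx.le, hterm]
  have hgeo := (hasSum_geometric_of_lt_one (Real.exp_pos _).le hq1).mul_left (Real.exp (-x))
  rw [← ENNReal.ofReal_tsum_of_nonneg (fun j => by positivity) hgeo.summable, hgeo.tsum_eq]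
  refine ENNReal.ofReal_le_one.2 ?_
  rw [← div_eq_mul_inv, div_le_one (by linarith)]
  have h3 : Real.exp (-(x / r)) ≤ 1 / (1 + x / r) := by
    rw [Real.exp_neg, ← one_div]
    exact one_div_le_one_div_of_le (by positivity) (by linarith [Real.add_one_le_exp (x / r)])
  have h4 : 1 - 1 / (1 + x / r) = x / (r + x) := by field_simp; ring
  have h5 : Real.exp (-x) ≤ x / (r + x) := by
    rw [Real.exp_neg, ← one_div, div_le_div_iff₀ (Real.exp_pos _) (by positivity)]
    linarith
  linarith

theorem ofReal_le_dimH_gaussCantor {r s : ℕ} (hr : 0 < r) {x : ℝ} (hx : 0 < x)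
    (h : x / r * Real.exp (x + 6 * x / r) ≤ 1 - Real.exp (-(x * s / r))) :
    ENNReal.ofReal (x / (goldenRate * r)) ≤ dimH (gaussCantor (alphabet r s)) := by
  have h2 : (0 : ℝ) < r := by exact_mod_cast hr
  have hlam := goldenRate_pos
  refine le_dimH_gaussCantor (Real.toNNReal_pos.2 (by positivity)) ?_
  have ht : 0 < x / r := by positivity
  set q := Real.exp (-(x / r)) with hq
  have hq0 : 0 < q := Real.exp_pos _
  have hq1 : q < 1 := Real.exp_lt_one_iff.2 (by linarith)
  have hterm : ∀ k : ℕ, Real.exp (-(x / r * (r + k + 6 : ℕ))) =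
      Real.exp (-(x + 6 * x / r)) * q ^ k := by
    intro k
    rw [hq, ← Real.exp_nat_mul, ← Real.exp_add]
    congr 1
    push_cast
    field_simp
    ring
  simp_rw [ofReal_rho_pow_rpow hr hx.le, hterm]
  rw [← ENNReal.ofReal_sum_of_nonneg (fun k _ => by positivity), ENNReal.one_le_ofReal,
    ← Finset.mul_sum, Fin.sum_univ_eq_sum_range (fun k => q ^ k), geom_sum_eq hq1.ne,
    Real.exp_neg, inv_mul_eq_div, le_div_iff₀ (Real.exp_pos _), one_mul,
    ← neg_div_neg_eq (q ^ (s + 1) - 1), neg_sub, neg_sub, le_div_iff₀ (by linarith)]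
  have h3 : 1 - q ≤ x / r := by linarith [Real.add_one_le_exp (-(x / r))]
  have h4 : q ^ (s + 1) ≤ Real.exp (-(x * s / r)) := by
    rw [hq, ← Real.exp_nat_mul]
    apply Real.exp_le_exp.2
    push_cast
    have : x * s / r = x / r * s := by ring
    rw [this]
    linarith
  have h5 := mul_le_mul_of_nonneg_left h3 (Real.exp_pos (x + 6 * x / r)).le
  linarith

/-! ### Lambert's function -/

theorem lambertW_spec {y : ℝ} (hy : 0 ≤ y) :
    -1 ≤ lambertW y ∧ lambertW y * Real.exp (lambertW y) = y := by
  have hex : ∃ x ∈ Set.Ici (-1 : ℝ), x * Real.exp x = y := by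
    have hc : ContinuousOn (fun x : ℝ => x * Real.exp x) (Set.Icc 0 y) := by fun_prop
    have hmem : y ∈ Set.Icc ((0 : ℝ) * Real.exp 0) (y * Real.exp y) := by
      refine ⟨by simpa using hy, le_mul_of_one_le_right hy (Real.one_le_exp hy)⟩
    obtain ⟨x, hx, h⟩ := intermediate_value_Icc hy hc hmem
    exact ⟨x, by simp only [Set.mem_Ici]; linarith [hx.1], h⟩
  exact ⟨Function.invFunOn_mem hex, Function.invFunOn_eq hex⟩

/-- Take logarithms in `w * exp w = y`: `w = log y - log w`, with `0 ≤ log w ≤ log (log y)`. -/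
theorem lambertW_bounds {y : ℝ} (hy : Real.exp 1 ≤ y) :
    1 ≤ lambertW y ∧ lambertW y ≤ Real.log y ∧
      Real.log y - Real.log (Real.log y) ≤ lambertW y := by
  have hy0 : 0 < y := (Real.exp_pos 1).trans_le hy
  obtain ⟨-, h⟩ := lambertW_spec hy0.le
  set w := lambertW y
  have h1 : 1 ≤ w := by
    by_contra! hlt
    have : w * Real.exp w < Real.exp 1 := by
      calc w * Real.exp w ≤ 1 * Real.exp w := by gcongr
        _ = Real.exp w := one_mul _
        _ < _ := Real.exp_lt_exp.2 hlt
    linarith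
  have hlog : Real.log y = Real.log w + w := by
    rw [← h, Real.log_mul (by linarith) (Real.exp_pos _).ne', Real.log_exp]
  have h0 := Real.log_nonneg h1
  have h2 : w ≤ Real.log y := by linarith
  refine ⟨h1, h2, ?_⟩
  have := Real.log_le_log (by linarith) h2
  linarith

theorem log_le_half {y : ℝ} (hy : 0 < y) : Real.log y ≤ y / 2 := by
  have h1 := Real.log_le_sub_one_of_pos (half_pos hy)
  rw [Real.log_div hy.ne' two_ne_zero] at h1
  linarith [Real.log_two_lt_d9]

/-! ### Explicit bounds for the dimension -/

theorem dimH_le_lambertW {r : ℕ} (hr : Real.exp 1 ≤ r) (s : ℕ∞) :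
    dimH (gaussCantor (alphabet r s)) ≤
      ENNReal.ofReal ((lambertW r + 2 * lambertW r / r) / (goldenRate * r)) := by
  have hr0 : (0 : ℝ) < r := (Real.exp_pos 1).trans_le hr
  have hW := (lambertW_bounds hr).1
  have h := (lambertW_spec hr0.le).2
  set W := lambertW r
  refine dimH_gaussCantor_le_ofReal (by exact_mod_cast hr0) (by positivity) ?_ s
  -- Since `exp W = r / W`, the value of `x * exp x` at `x = W + 2 * W / r` is `(r + 2) * exp (2 * W
  -- / r)`.
  have h1 := Real.add_one_le_exp (2 * W / r)
  have hr1 : (2 : ℝ) ≤ r := by linarith [Real.add_one_le_exp (1 : ℝ)]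
  calc (r : ℝ) + (W + 2 * W / r) ≤ (r + 2) * (2 * W / r + 1) := by
        have : (r + 2) * (2 * W / r + 1) = r + 2 + 2 * W + 2 * (2 * W / r) := by
          field_simp
          ring
        have : 0 ≤ 2 * W / r := by positivity
        linarith
    _ ≤ (r + 2) * Real.exp (2 * W / r) := by gcongr
    _ = (W + 2 * W / r) * Real.exp (W + 2 * W / r) := by
        have h2 : Real.exp W = r / W := by field_simp; linarith
        rw [Real.exp_add, h2]
        field_simp

theorem lambertW_le_dimH {r s : ℕ} {c A : ℝ} (hr : Real.exp 1 ≤ r)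
    (hc : 0 < c) (hA : A = 1 / (1 - Real.exp (-c))) (hW : 2 * (1 + A) ≤ lambertW r)
    (hWr : 6 * lambertW r / r ≤ 1) (hs : 2 * c ≤ lambertW r * s / r) :
    ENNReal.ofReal ((lambertW r - (6 * lambertW r / r +
      A * Real.exp (-((lambertW r - (1 + A)) * s / r)))) / (goldenRate * r)) ≤
        dimH (gaussCantor (alphabet r s)) := by
  have hr0 : (0 : ℝ) < r := (Real.exp_pos 1).trans_le hr
  have h := (lambertW_spec hr0.le).2
  have hW1 := (lambertW_bounds hr).1
  set W := lambertW r
  have hη : Real.exp (-c) < 1 := Real.exp_lt_one_iff.2 (by linarith)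
  have hA0 : 0 < A := by rw [hA]; exact one_div_pos.2 (by linarith)
  set q₀ := Real.exp (-((W - (1 + A)) * s / r)) with hq₀
  have hq₀0 : 0 < q₀ := Real.exp_pos _
  have hq₀1 : q₀ ≤ 1 := by
    apply Real.exp_le_one_iff.2
    have : 0 ≤ (W - (1 + A)) * s / r := by
      have : 0 ≤ W - (1 + A) := by linarith
      positivity
    linarith
  -- The first term pays for the shift 6, the second for truncation. Using `W - (1 + A)` in `q₀`, an
  -- a priori lower bound for `W - δ`, avoids a circular definition.
  set δ := 6 * W / r + A * q₀ with hδ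
  have hδ1 : δ ≤ 1 + A := by
    have : A * q₀ ≤ A := mul_le_of_le_one_right hA0.le hq₀1
    linarith
  have hδ0 : 0 ≤ δ := by positivity
  have hx : 0 < W - δ := by linarith
  refine ofReal_le_dimH_gaussCantor (by exact_mod_cast hr0) hx ?_
  set q := Real.exp (-((W - δ) * s / r)) with hq
  have hq0 : 0 < q := Real.exp_pos _
  have hqq₀ : q ≤ q₀ := by
    apply Real.exp_le_exp.2
    have : (W - (1 + A)) * s / r ≤ (W - δ) * s / r := by gcongr
    linarith
  have hqη : q ≤ Real.exp (-c) := by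
    apply Real.exp_le_exp.2
    have : W / 2 * s / r ≤ (W - δ) * s / r := by gcongr; linarith
    have : W / 2 * s / r = W * s / r / 2 := by ring
    linarith
  have hAq : 1 ≤ A * (1 - q) := by
    rw [hA, div_mul_eq_mul_div, one_mul, le_div_iff₀ (by linarith)]
    linarith
  -- Follows from `(1 - q) * (1 + A * q) = 1 + q * (A * (1 - q) - 1) ≥ 1`.
  have hkey : Real.exp (-(A * q)) ≤ 1 - q := by
    rw [Real.exp_neg, inv_le_comm₀ (Real.exp_pos _) (by linarith)]
    refine le_trans ?_ (Real.add_one_le_exp (A * q))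
    rw [inv_le_iff_one_le_mul₀ (by linarith)]
    nlinarith
  refine le_trans ?_ hkey
  calc (W - δ) / r * Real.exp (W - δ + 6 * (W - δ) / r)
      ≤ W / r * Real.exp (W + (-(A * q))) := by
        have h6 : 6 * (W - δ) / r ≤ 6 * W / r := by gcongr; linarith
        have : A * q ≤ A * q₀ := by gcongr
        exact mul_le_mul (by gcongr; linarith) (Real.exp_le_exp.2 (by linarith))
          (Real.exp_pos _).le (by positivity)
    _ = Real.exp (-(A * q)) := by
        rw [Real.exp_add, div_mul_eq_mul_div, ← mul_assoc, h, mul_div_right_comm,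
          div_self hr0.ne', one_mul]

/-- If `s ≤ r`, then `C * r ≤ s * log s ≤ s * log r ≤ 2 * s * W`, as `W ≥ log r / 2`. If `s > r`,
then `W ≥ 1` suffices. -/
theorem lambertW_mul_div_ge {C : ℝ} (hC : 0 < C) {r s : ℕ} (hr : Real.exp 1 ≤ r)
    (h : C ≤ (s : ℝ) * Real.log s / (r + s + 5)) :
    min (C / 2) 1 ≤ lambertW r * s / r := by
  have hr0 : (0 : ℝ) < r := (Real.exp_pos 1).trans_le hr
  obtain ⟨hW1, -, hW2⟩ := lambertW_bounds hr
  have hlog1 : 1 ≤ Real.log r := (Real.le_log_iff_exp_le hr0).2 hr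
  have hhalf := log_le_half (by linarith : 0 < Real.log r)
  rcases le_or_gt s r with hsr | hsr
  · refine (min_le_left _ _).trans ?_
    rw [le_div_iff₀ (by positivity)] at h
    rw [le_div_iff₀ hr0]
    have h1 : (s : ℝ) * Real.log s ≤ s * Real.log r := by
      rcases Nat.eq_zero_or_pos s with rfl | hs0
      · simp
      · have : (0 : ℝ) < s := by exact_mod_cast hs0
        gcongr
    have h2 : (s : ℝ) * Real.log r ≤ s * (2 * lambertW r) := by gcongr; linarith
    have h3 : C * r ≤ C * (r + s + 5) := by gcongr; linarith [(Nat.cast_nonneg s : (0 : ℝ) ≤ s)]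
    linarith
  · refine (min_le_right _ _).trans ?_
    rw [le_div_iff₀ hr0]
    have : (r : ℝ) ≤ s := by exact_mod_cast hsr.le
    nlinarith

/-! ### Asymptotics -/

theorem tendsto_log_natCast : Tendsto (fun r : ℕ => Real.log (r : ℝ)) atTop atTop :=
  Real.tendsto_log_atTop.comp tendsto_natCast_atTop_atTop

theorem tendsto_log_sub_log_log :
    Tendsto (fun r : ℕ => Real.log (r : ℝ) - Real.log (Real.log r)) atTop atTop := by
  refine tendsto_atTop_mono' atTop ?_ (tendsto_log_natCast.atTop_div_const (two_pos : (0 : ℝ) < 2))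
  filter_upwards [tendsto_log_natCast.eventually_gt_atTop 0] with r hr
  linarith [log_le_half hr]

theorem log_div_self_eq_exp {r : ℕ} (hr : Real.exp 1 ≤ r) :
    Real.log r / r = Real.exp (-(Real.log (r : ℝ) - Real.log (Real.log r))) := by
  have hr0 : (0 : ℝ) < r := (Real.exp_pos 1).trans_le hr
  have hlog1 : 1 ≤ Real.log r := (Real.le_log_iff_exp_le hr0).2 hr
  rw [neg_sub, Real.exp_sub, Real.exp_log (by linarith), Real.exp_log hr0]

theorem abs_toReal_dimH_sub_le {r t : ℕ} {s : ℕ∞} {c A : ℝ} (hr : Real.exp 1 ≤ r)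
    (hc : 0 < c) (hA : A = 1 / (1 - Real.exp (-c))) (hW : 2 * (1 + A) ≤ lambertW r)
    (hWr : 6 * (Real.log r / r) ≤ 1) (hts : (t : ℕ∞) ≤ s) (ht : 2 * c ≤ lambertW r * t / r) :
    |(dimH (gaussCantor (alphabet r s))).toReal - lambertW r / (r * goldenRate)| ≤
      1 / (goldenRate * r) * (6 * (Real.log r / r) +
        A * Real.exp (-((lambertW r - (1 + A)) * t / r))) := by
  have hr0 : (0 : ℝ) < r := (Real.exp_pos 1).trans_le hr
  have hlam := goldenRate_pos
  obtain ⟨hW1, hW2, -⟩ := lambertW_bounds hr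
  have hη : Real.exp (-c) < 1 := Real.exp_lt_one_iff.2 (by linarith)
  have hA0 : 0 < A := by rw [hA]; exact one_div_pos.2 (by linarith)
  have hWlog : lambertW r / r ≤ Real.log r / r := by gcongr
  have e1 : 6 * lambertW r / r = 6 * (lambertW r / r) := mul_div_assoc _ _ _
  have e2 : 2 * lambertW r / r = 2 * (lambertW r / r) := mul_div_assoc _ _ _
  have hup := dimH_le_lambertW hr s
  have hlow := (lambertW_le_dimH hr hc hA hW (by linarith) ht).trans
    (dimH_mono (gaussCantor_alphabet_mono r hts))
  have hlow' := (ENNReal.ofReal_le_iff_le_toReal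
    (ne_top_of_le_ne_top ENNReal.ofReal_ne_top hup)).1 hlow
  have hup' := ENNReal.toReal_le_of_le_ofReal (by positivity) hup
  set W := lambertW r
  set q := Real.exp (-((W - (1 + A)) * t / r))
  have hq : 0 < q := Real.exp_pos _
  have hpos : 0 < 1 / (goldenRate * r) := by positivity
  have e3 : W / (r * goldenRate) = 1 / (goldenRate * r) * W := by rw [mul_comm]; ring
  rw [div_eq_mul_one_div, mul_comm] at hlow' hup'
  have hAq : 0 < A * q := by positivity
  have hl : 0 ≤ Real.log r / r := by positivity
  have h1 : 1 / (goldenRate * r) * (W + 2 * W / r) ≤ 1 / (goldenRate * r) *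
      (W + (6 * (Real.log r / r) + A * q)) := by gcongr; linarith
  have h2 : 1 / (goldenRate * r) * (W - (6 * (Real.log r / r) + A * q)) ≤
      1 / (goldenRate * r) * (W - (6 * W / r + A * q)) := by gcongr; linarith
  rw [abs_le, e3]
  constructor <;> linarith

theorem abs_toReal_dimH_sub_le_errorExponent {r : ℕ} {s : ℕ∞} {C c A : ℝ} (hC : 0 < C) (hs : GrowthBound C r s)
    (hr : Real.exp 1 ≤ r) (hc : c = min (C / 2) 1 / 2) (hA : A = 1 / (1 - Real.exp (-c)))
    (hL : 2 * (1 + A) ≤ Real.log (r : ℝ) - Real.log (Real.log r))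
    (hWr : 6 * (Real.log r / r) ≤ 1) :
    |(dimH (gaussCantor (alphabet r s))).toReal - lambertW r / (r * goldenRate)| ≤
      (6 + A) / goldenRate * (1 / r * (Real.log r / r) ^ errorExponent r s
        (-(1 + A) / (Real.log (r : ℝ) - Real.log (Real.log r)))) := by
  have hr0 : (0 : ℝ) < r := (Real.exp_pos 1).trans_le hr
  have hlam := goldenRate_pos
  obtain ⟨hW1, hW2, hW3⟩ := lambertW_bounds hr
  have hc0 : 0 < c := by rw [hc]; positivity
  have hη : Real.exp (-c) < 1 := Real.exp_lt_one_iff.2 (by linarith)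
  have hA0 : 0 < A := by rw [hA]; exact one_div_pos.2 (by linarith)
  set W := lambertW r
  set l := Real.log (r : ℝ) - Real.log (Real.log r)
  have hl0 : 0 < l := by linarith
  have hb := log_div_self_eq_exp hr
  have key : ∀ t : ℕ, (t : ℕ∞) ≤ s → 2 * c ≤ W * t / r →
      Real.exp (-((W - (1 + A)) * t / r)) ≤
        (Real.log r / r) ^ errorExponent r s (-(1 + A) / l) →
      |(dimH (gaussCantor (alphabet r s))).toReal - W / (r * goldenRate)| ≤
      (6 + A) / goldenRate * (1 / r * (Real.log r / r) ^ errorExponent r s (-(1 + A) / l)) := by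
    intro t hts ht hE
    refine (abs_toReal_dimH_sub_le hr hc0 hA (hL.trans hW3) hWr hts ht).trans ?_
    have hE1 : errorExponent r s (-(1 + A) / l) ≤ 1 := by
      unfold errorExponent
      split_ifs
      · exact le_rfl
      · exact min_le_left _ _
    have hb1 : Real.log r / r ≤ (Real.log r / r) ^ errorExponent r s (-(1 + A) / l) := by
      conv_lhs => rw [← Real.rpow_one (Real.log r / r)]
      refine Real.rpow_le_rpow_of_exponent_ge ?_ ?_ hE1
      · rw [hb]; exact Real.exp_pos _
      · rw [hb]; exact Real.exp_le_one_iff.2 (by linarith)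
    calc _ ≤ 1 / (goldenRate * r) *
          (6 * (Real.log r / r) ^ errorExponent r s (-(1 + A) / l) +
            A * (Real.log r / r) ^ errorExponent r s (-(1 + A) / l)) := by gcongr
      _ = _ := by field_simp
  have hexp : ∀ x : ℝ, (Real.log r / r) ^ x = Real.exp (-(l * x)) := by
    intro x
    rw [hb, ← Real.exp_mul, neg_mul]
  have hc2 : 2 * c = min (C / 2) 1 := by rw [hc]; ring
  by_cases htop : s = ⊤
  -- An infinite alphabet is cut at `2 * r`: as `W ≥ l ≥ 2 * (1 + A)`, the truncation term is at
  -- most `exp (-l) = log r / r`.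
  · refine key (2 * r) (htop ▸ le_top) ?_ ?_
    · rw [hc2]
      refine (min_le_right _ _).trans ?_
      rw [le_div_iff₀ hr0]
      push_cast
      nlinarith
    · rw [hexp, errorExponent, if_pos htop, mul_one]
      apply Real.exp_le_exp.2
      have : (W - (1 + A)) * (2 * r : ℕ) / r = 2 * (W - (1 + A)) := by
        push_cast
        field_simp
      rw [this]
      linarith
  · have hcoe : ((s.toNat : ℕ) : ℕ∞) = s := ENat.natCast_toNat htop
    refine key s.toNat hcoe.le ?_ ?_
    · rw [hc2]
      exact lambertW_mul_div_ge hC hr (hs.resolve_left htop)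
    · rw [hexp, errorExponent, if_neg htop]
      apply Real.exp_le_exp.2
      rw [neg_le_neg_iff]
      calc l * min 1 ((1 + -(1 + A) / l) * s.toNat / r)
          ≤ l * ((1 + -(1 + A) / l) * s.toNat / r) := by gcongr; exact min_le_right _ _
        _ = (l - (1 + A)) * s.toNat / r := by field_simp; ring
        _ ≤ (W - (1 + A)) * s.toNat / r := by gcongr

end GaussCantor

theorem mainTheorem11 (s : ℕ → ℕ∞) (C : ℝ) (hC : 0 < C)
    (hs : ∀ᶠ r : ℕ in Filter.atTop, GaussCantor.GrowthBound C r (s r)) :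
    ∃ ε : ℕ → ℝ, Filter.Tendsto ε Filter.atTop (nhds 0) ∧
      (fun r : ℕ =>
          (dimH (GaussCantor.gaussCantor (GaussCantor.alphabet r (s r)))).toReal
            - GaussCantor.lambertW (r : ℝ) / ((r : ℝ) * Real.exp (-GaussCantor.c₀)))
        =O[Filter.atTop]
      (fun r : ℕ =>
          1 / (r : ℝ) * (Real.log (r : ℝ) / (r : ℝ))
            ^ GaussCantor.errorExponent r (s r) (ε r)) := by
  obtain ⟨A, hA⟩ : ∃ A, A = 1 / (1 - Real.exp (-(min (C / 2) 1 / 2))) := ⟨_, rfl⟩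
  -- With `l` the denominator, `l * (1 + ε) = l - (1 + A)`, which matches the exponent in the
  -- truncation error because `W ≥ l`.
  refine ⟨fun r => -(1 + A) / (Real.log (r : ℝ) - Real.log (Real.log r)),
    GaussCantor.tendsto_log_sub_log_log.const_div_atTop _, ?_⟩
  refine Asymptotics.IsBigO.of_bound ((6 + A) / GaussCantor.goldenRate) ?_
  have hlim : Tendsto (fun r : ℕ => Real.log (r : ℝ) / r) atTop (𝓝 0) :=
    (Real.isLittleO_log_id_atTop.tendsto_div_nhds_zero).comp tendsto_natCast_atTop_atTop
  filter_upwards [hs, GaussCantor.tendsto_log_sub_log_log.eventually_ge_atTop (2 * (1 + A)),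
    hlim.eventually_le_const (show (0 : ℝ) < 1 / 6 by norm_num),
    tendsto_natCast_atTop_atTop.eventually_ge_atTop (Real.exp 1)] with r h1 h2 h3 h4
  have hr0 : (0 : ℝ) < r := (Real.exp_pos 1).trans_le h4
  have hb : 0 ≤ Real.log r / r := by
    rw [GaussCantor.log_div_self_eq_exp h4]
    exact (Real.exp_pos _).le
  rw [GaussCantor.exp_neg_c₀, Real.norm_eq_abs, Real.norm_of_nonneg (by positivity)]
  exact GaussCantor.abs_toReal_dimH_sub_le_errorExponent hC h1 h4 rfl hA h2 (by linarith)
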